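/- Let $(S,+,0)$ be a commutative semigroup with unit $0$, directed by the preorder $s\le t \iff \exists r\in S,\ s+r=t$; $\lim_s$ denotes the limit along this directed set. Let $N\subset B(H)$ be a von Neumann algebra on a complex Hilbert space $H$, and let $\{\phi_s\}_{s\in S}$ be a family of completely positive, contractive, weak*-continuous linear maps $\phi_s:N\to N$ forming a semigroup, i.e. $\phi_0=\mathrm{id}_N$ and $\phi_{s+t}=\phi_s\circ\phi_t$ for all $s,t\in S$. Let $$N^\phi=\{x\in N:\ \phi_t(x)=x\ \ \forall t\in S\},$$ and let $C^*(N^\phi)$ be the (not necessarily unital) $C^*$-subalgebra of $N$ generated by $N^\phi$. Then for each $y\in C^*(N^\phi)$ the limit $$\Phi(y)=\lim_s\phi_s(y)$$ exists in the strong operator topology and belongs to $C^*(N^\phi)$, and the map $\Phi:C^*(N^\phi)\to C^*(N^\phi)$ is linear, completely positive, contractive and idempotent, with range $\mathrm{Ran}(\Phi)=N^\phi$. -/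

import Mathlib

open Filter Topology
open scoped CStarAlgebra InnerProductSpace

/-! ### The canonical preorder on a commutative monoid -/

/-- The preorder `s ≤ t ↔ ∃ r, s + r = t` on a commutative semigroup with unit. It is directed,
since `s + t` is an upper bound of `s` and `t`. -/
@[reducible] def monoidPreorder (S : Type*) [AddCommMonoid S] : Preorder S where
  le s t := ∃ r, s + r = t
  le_refl s := ⟨0, add_zero s⟩
  le_trans _ _ _ := fun ⟨r, hr⟩ ⟨q, hq⟩ => ⟨r + q, by rw [← hq, ← hr, add_assoc]⟩

/-- The filter of the final sections of the directed set `(S, ≤)`: a limit along it is the limit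
of a net indexed by `(S, ≤)`. -/
def monoidAtTop (S : Type*) [AddCommMonoid S] : Filter S :=
  @atTop S (monoidPreorder S)

/-! ### C*-subalgebras with the order of the ambient algebra -/

/-- In a norm-closed `*`-subalgebra of a C*-algebra, the order inherited from the ambient algebra
is the C*-algebra order of the subalgebra. -/
instance closedSubalgebra_starOrderedRing {A T : Type*} [NonUnitalCStarAlgebra A]
    [PartialOrder A] [StarOrderedRing A] [SetLike T A] [NonUnitalSubringClass T A]
    [SMulMemClass T ℂ A] [StarMemClass T A] (B : T) [hB : IsClosed (B : Set A)] :
    StarOrderedRing B := by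
  refine StarOrderedRing.of_nonneg_iff' (fun {x y} h z => ?_) (fun x => ⟨fun hx => ?_, ?_⟩)
  · exact add_le_add_right (α := A) h z
  · have hx' : (0 : A) ≤ (x : A) := hx
    have hmem : CFC.sqrt (x : A) ∈ B := by
      rw [CFC.sqrt, cfcₙ_nnreal_eq_real _ _]
      exact cfcₙ_mem (𝕜' := ℂ) _ x.2
    refine ⟨⟨CFC.sqrt (x : A), hmem⟩, Subtype.ext ?_⟩
    change (x : A) = star (CFC.sqrt (x : A)) * CFC.sqrt (x : A)
    rw [(IsSelfAdjoint.of_nonneg (CFC.sqrt_nonneg (x : A))).star_eq, CFC.sqrt_mul_sqrt_self _ hx']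
  · rintro ⟨s, rfl⟩
    exact star_mul_self_nonneg (s : A)

/-- The C*-subalgebra generated by a set `X` in a C*-algebra: the norm closure of the
(not necessarily unital) `*`-algebra generated by `X`. -/
def generatedCStar {A : Type*} [NonUnitalCStarAlgebra A] (X : Set A) :
    NonUnitalStarSubalgebra ℂ A :=
  (NonUnitalStarAlgebra.adjoin ℂ X).topologicalClosure

instance generatedCStar_isClosed {A : Type*} [NonUnitalCStarAlgebra A] (X : Set A) :
    IsClosed (generatedCStar X : Set A) :=
  NonUnitalStarSubalgebra.isClosed_topologicalClosure _

/-! ### Von Neumann algebras as C*-algebras -/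

section VonNeumann

variable {H : Type*} [NormedAddCommGroup H] [InnerProductSpace ℂ H] [CompleteSpace H]

instance vonNeumann_smulMemClass : SMulMemClass (VonNeumannAlgebra H) ℂ (H →L[ℂ] H) where
  smul_mem {N} c _ hx := N.toStarSubalgebra.smul_mem hx c

instance vonNeumann_isClosed (N : VonNeumannAlgebra H) : IsClosed (N : Set (H →L[ℂ] H)) := by
  rw [← N.centralizer_centralizer]
  exact Set.isClosed_centralizer _

/-- The weak* topology of a von Neumann algebra `N ⊆ B(H)` with respect to its predual, that is,
the ultraweak (σ-weak) topology: the coarsest one that makes all the normal functionals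
`x ↦ ∑ₙ ⟪ξₙ, x ηₙ⟫` with `∑ₙ ‖ξₙ‖² < ∞` and `∑ₙ ‖ηₙ‖² < ∞` continuous. -/
@[reducible] noncomputable def weakStarTopology (N : VonNeumannAlgebra H) : TopologicalSpace N :=
  ⨅ p : {p : (ℕ → H) × (ℕ → H) //
      Summable (fun n => ‖p.1 n‖ ^ 2) ∧ Summable (fun n => ‖p.2 n‖ ^ 2)},
    TopologicalSpace.induced
      (fun x : N => ∑' n, ⟪p.1.1 n, (x : H →L[ℂ] H) (p.1.2 n)⟫_ℂ) inferInstance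

/-- Convergence of a family of bounded operators along a filter in the strong operator topology. -/
def TendstoSOT {ι : Type*} (f : ι → (H →L[ℂ] H)) (l : Filter ι) (T : H →L[ℂ] H) : Prop :=
  ∀ h : H, Tendsto (fun i => f i h) l (𝓝 (T h))

/-- The common fixed points `N^φ` of a family of completely positive maps on `N`. -/
def commonFixedPoints {S : Type*} {N : VonNeumannAlgebra H} (φ : S → (N →CP N)) : Set N :=
  {x | ∀ s, φ s x = x}

end VonNeumann

/-! Let F be the space of common fixed points. For x in F the Schwarz inequality gives x*x ≤
φ_r(x*x), so the orbit of x*x is increasing and bounded and converges strongly to some z;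
weak*-continuity puts z in F. The defect d = z - x*x is positive and φ_s(d) → 0 weakly.

Let K be the set of c with φ_s(c*c) → 0 weakly (`asymptoticKernel`). It is a left ideal, it contains
d because d² ≤ ‖d‖d, and φ_s(c) → 0 strongly for c in K, again by Schwarz. Hence x*x lies in F + K,
and by polarization so does every product of two fixed points (`mul_mem_sup`). Therefore F + K is
stable under left multiplication by F and contains the *-algebra generated by F
(`mem_sup_of_mem_adjoin`).

On z + c with z in F and c in K the orbit converges strongly to z. Contractivity extends convergence
to the norm closure (`isClosed_setOf_tendstoSOT`), and complete positivity survives the limit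
because positivity of a matrix is tested on vectors. -/

section FixedPointLimits

open scoped ComplexOrder

/-! ### Positivity of operator matrices -/

/-- An injective `*`-homomorphism between C*-algebras reflects positivity. -/
theorem NonUnitalStarAlgHom.nonneg_of_map_nonneg {A B : Type*} [NonUnitalCStarAlgebra A]
    [PartialOrder A] [StarOrderedRing A] [NonUnitalCStarAlgebra B] [PartialOrder B]
    [StarOrderedRing B] (π : A →⋆ₙₐ[ℂ] B) (hπ : Function.Injective π) {a : A}
    (ha : 0 ≤ π a) : 0 ≤ a := by
  have hsa : IsSelfAdjoint a := by
    refine hπ ?_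
    rw [map_star, (IsSelfAdjoint.of_nonneg ha).star_eq]
  rw [← CFC.negPart_eq_zero_iff a hsa]
  refine hπ ?_
  have hπa : IsSelfAdjoint (π a) := .of_nonneg ha
  -- A *-homomorphism commutes with the functional calculus, so π kills the negative part of a.
  have hmap : π (a⁻) = (π a)⁻ := by
    rw [CFC.negPart_def, CFC.negPart_def]
    exact π.map_cfcₙ (fun x : ℝ => x⁻) a
  rw [hmap, map_zero, CFC.negPart_eq_zero_iff (π a) hπa]
  exact ha

section MatrixRep

variable {H : Type*} [NormedAddCommGroup H] [InnerProductSpace ℂ H]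
variable {A : Type*} [NonUnitalCStarAlgebra A] {n : Type*} [Fintype n]

/-- The operator on `Hⁿ` given by a matrix of operators on `H`. -/
noncomputable def operatorOfMatrix (T : n → n → (H →L[ℂ] H)) :
    PiLp 2 (fun _ : n => H) →L[ℂ] PiLp 2 (fun _ : n => H) :=
  ((PiLp.continuousLinearEquiv 2 ℂ (fun _ : n => H)).symm : _ →L[ℂ] _) ∘L
    ContinuousLinearMap.pi (fun i => ∑ j, T i j ∘L PiLp.proj 2 (𝕜 := ℂ) (fun _ : n => H) j)

@[simp]
theorem operatorOfMatrix_apply (T : n → n → (H →L[ℂ] H)) (ξ : PiLp 2 (fun _ : n => H)) (i : n) :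
    operatorOfMatrix T ξ i = ∑ j, T i j (ξ j) := by
  simp [operatorOfMatrix]

theorem inner_operatorOfMatrix (T : n → n → (H →L[ℂ] H)) (ξ η : PiLp 2 (fun _ : n => H)) :
    ⟪ξ, operatorOfMatrix T η⟫_ℂ = ∑ i, ∑ j, ⟪ξ i, T i j (η j)⟫_ℂ := by
  simp [PiLp.inner_apply, inner_sum]

variable [CompleteSpace H]

/-- The amplification to matrices of a representation on a Hilbert space. -/
noncomputable def matrixRep (π : A →⋆ₙₐ[ℂ] (H →L[ℂ] H)) :
    CStarMatrix n n A →⋆ₙₐ[ℂ] (PiLp 2 (fun _ : n => H) →L[ℂ] PiLp 2 (fun _ : n => H)) where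
  toFun M := operatorOfMatrix fun i j => π (M i j)
  map_smul' c M := by ext ξ i; simp [Finset.smul_sum]
  map_zero' := by ext ξ i; simp
  map_add' M M' := by ext ξ i; simp [Finset.sum_add_distrib]
  map_mul' M M' := by
    ext ξ i
    simp only [operatorOfMatrix_apply, mul_apply_eq_comp, CStarMatrix.mul_apply,
      map_sum, map_mul, sum_apply]
    rw [Finset.sum_comm]
  map_star' M := by
    rw [ContinuousLinearMap.star_eq_adjoint, ContinuousLinearMap.eq_adjoint_iff]
    intro ξ η
    rw [inner_operatorOfMatrix, ← inner_conj_symm, inner_operatorOfMatrix, map_sum,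
      Finset.sum_comm]
    refine Finset.sum_congr rfl fun i _ => ?_
    rw [map_sum]
    refine Finset.sum_congr rfl fun j _ => ?_
    rw [inner_conj_symm, CStarMatrix.star_apply, map_star, ContinuousLinearMap.star_eq_adjoint,
      ContinuousLinearMap.adjoint_inner_left]

theorem inner_matrixRep (π : A →⋆ₙₐ[ℂ] (H →L[ℂ] H)) (M : CStarMatrix n n A)
    (ξ η : PiLp 2 (fun _ : n => H)) :
    ⟪ξ, matrixRep π M η⟫_ℂ = ∑ i, ∑ j, ⟪ξ i, π (M i j) (η j)⟫_ℂ :=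
  inner_operatorOfMatrix _ ξ η

theorem matrixRep_injective (π : A →⋆ₙₐ[ℂ] (H →L[ℂ] H)) (hπ : Function.Injective π) :
    Function.Injective (matrixRep (n := n) π) := by
  classical
  intro M M' h
  refine CStarMatrix.ext fun i j => hπ <| ContinuousLinearMap.ext fun v => ?_
  have := congrArg (fun T => T (WithLp.toLp 2 (Pi.single j v)) i) h
  simpa [matrixRep, Pi.single_apply, apply_ite] using this

/-- A matrix over a C*-algebra that is represented faithfully on `H` is positive if and only if
it is positive as an operator on `Hⁿ`. -/
theorem CStarMatrix.nonneg_iff_inner [PartialOrder A] [StarOrderedRing A]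
    (π : A →⋆ₙₐ[ℂ] (H →L[ℂ] H)) (hπ : Function.Injective π) (M : CStarMatrix n n A) :
    0 ≤ M ↔ ∀ ξ : n → H, 0 ≤ ∑ i, ∑ j, ⟪ξ i, π (M i j) (ξ j)⟫_ℂ := by
  constructor
  · intro hM ξ
    have h := (ContinuousLinearMap.nonneg_iff_isPositive _).1 (map_nonneg (matrixRep π) hM)
    simpa [inner_matrixRep] using h.inner_nonneg_right (WithLp.toLp 2 ξ)
  · intro h
    refine (matrixRep π).nonneg_of_map_nonneg (matrixRep_injective π hπ) ?_
    rw [ContinuousLinearMap.nonneg_iff_isPositive, ContinuousLinearMap.isPositive_iff_complex]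
    intro ξ
    have hξ : 0 ≤ ⟪matrixRep π M ξ, ξ⟫_ℂ := by
      rw [← inner_conj_symm, inner_matrixRep]
      exact star_nonneg_iff.2 (h ξ)
    rw [Complex.nonneg_iff] at hξ
    exact ⟨Complex.ext rfl hξ.2, hξ.1⟩

end MatrixRep

/-! ### The Schwarz inequality -/

section Schwarz

variable {H : Type*} [NormedAddCommGroup H] [InnerProductSpace ℂ H] [CompleteSpace H]
  {N : VonNeumannAlgebra H}

theorem VonNeumannAlgebra.nonneg_iff_inner {x : N} :
    0 ≤ x ↔ ∀ h : H, 0 ≤ ⟪h, (x : H →L[ℂ] H) h⟫_ℂ := by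
  change 0 ≤ (x : H →L[ℂ] H) ↔ _
  rw [ContinuousLinearMap.nonneg_iff_isPositive]
  refine ⟨fun hx h => hx.inner_nonneg_right h, fun hx => ?_⟩
  rw [ContinuousLinearMap.isPositive_iff_complex]
  intro h
  have hh : 0 ≤ ⟪(x : H →L[ℂ] H) h, h⟫_ℂ := by
    rw [← inner_conj_symm]
    exact star_nonneg_iff.2 (hx h)
  rw [Complex.nonneg_iff] at hh
  exact ⟨Complex.ext rfl hh.2, hh.1⟩

theorem VonNeumannAlgebra.inner_star_mul (x y : N) (h k : H) :
    ⟪h, ((star x * y : N) : H →L[ℂ] H) k⟫_ℂ = ⟪(x : H →L[ℂ] H) h, (y : H →L[ℂ] H) k⟫_ℂ := by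
  change ⟪h, (star (x : H →L[ℂ] H) * (y : H →L[ℂ] H)) k⟫_ℂ = _
  rw [mul_apply_eq_comp, ContinuousLinearMap.star_eq_adjoint,
    ContinuousLinearMap.adjoint_inner_right]

/-- Contractive completely positive maps satisfy the Schwarz inequality. -/
theorem CompletelyPositiveMap.schwarz (φ : N →CP N) (hφ : ∀ x, ‖φ x‖ ≤ ‖x‖) (c : N) :
    star (φ c) * φ c ≤ φ (star c * c) := by
  let π : N →⋆ₙₐ[ℂ] (H →L[ℂ] H) := NonUnitalStarSubalgebraClass.subtype N
  have hπ : Function.Injective π := Subtype.val_injective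
  -- M is the Gram matrix of the row (c, 1), hence positive; 2-positivity of φ is all that is used.
  let a : Fin 2 → N := ![c, 1]
  let M : CStarMatrix (Fin 2) (Fin 2) N := CStarMatrix.ofMatrix fun i j => star (a i) * a j
  have hM : 0 ≤ M := by
    rw [CStarMatrix.nonneg_iff_inner π hπ]
    intro ξ
    have : ∑ i, ∑ j, ⟪ξ i, π (M i j) (ξ j)⟫_ℂ
        = ⟪∑ i, (a i : H →L[ℂ] H) (ξ i), ∑ j, (a j : H →L[ℂ] H) (ξ j)⟫_ℂ := by
      simp_rw [sum_inner, inner_sum]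
      exact Finset.sum_congr rfl fun i _ => Finset.sum_congr rfl fun j _ =>
        VonNeumannAlgebra.inner_star_mul _ _ _ _
    rw [this, inner_self_eq_norm_sq_to_K]
    positivity
  have hφM := (CStarMatrix.nonneg_iff_inner π hπ _).1 (φ.map_cstarMatrix_nonneg M hM)
  rw [← sub_nonneg, VonNeumannAlgebra.nonneg_iff_inner]
  intro h
  set k : H := (φ c : H →L[ℂ] H) h with hk
  have h1 : 0 ≤ ⟪h, (φ (star c * c) : H →L[ℂ] H) h⟫_ℂ - ⟪k, k⟫_ℂ - ⟪k, k⟫_ℂ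
      + ⟪k, (φ 1 : H →L[ℂ] H) k⟫_ℂ := by
    have hstar : ⟪h, ((φ (star c) : N) : H →L[ℂ] H) k⟫_ℂ = ⟪k, k⟫_ℂ := by
      rw [map_star, hk, ← VonNeumannAlgebra.inner_star_mul]
      rfl
    -- The vector (h, -φ(c)h) completes the square; the leftover term ⟪k, φ(1)k⟫ is absorbed by φ(1)
    -- ≤ 1.
    have := hφM ![h, -k]
    have e₀₀ : M 0 0 = star c * c := rfl
    have e₀₁ : M 0 1 = star c := mul_one _
    have e₁₀ : M 1 0 = c := (congrArg (· * c) (star_one N)).trans (one_mul c)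
    have e₁₁ : M 1 1 = 1 := (congrArg (· * (1 : N)) (star_one N)).trans (one_mul 1)
    simp only [Fin.sum_univ_two, CStarMatrix.map_apply, e₀₀, e₀₁, e₁₀, e₁₁,
      Matrix.cons_val_zero, Matrix.cons_val_one] at this
    change 0 ≤ ⟪h, ((φ (star c * c) : N) : H →L[ℂ] H) h⟫_ℂ
      + ⟪h, ((φ (star c) : N) : H →L[ℂ] H) (-k)⟫_ℂ + (⟪-k, ((φ c : N) : H →L[ℂ] H) h⟫_ℂ
      + ⟪-k, ((φ 1 : N) : H →L[ℂ] H) (-k)⟫_ℂ) at this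
    rw [map_neg, map_neg, inner_neg_right, inner_neg_neg, inner_neg_left, hstar, ← hk] at this
    convert this using 1
    ring
  have h2 : (0 : N) ≤ φ 1 := map_nonneg φ zero_le_one
  have h3 : 0 ≤ ⟪k, k⟫_ℂ - ⟪k, (φ 1 : H →L[ℂ] H) k⟫_ℂ := by
    have hle : φ 1 ≤ 1 := by
      rw [← CStarAlgebra.norm_le_one_iff_of_nonneg (φ 1) h2]
      refine (hφ 1).trans ?_
      exact (CStarAlgebra.norm_le_one_iff_of_nonneg (1 : N) zero_le_one).2 le_rfl
    have := VonNeumannAlgebra.nonneg_iff_inner.1 (sub_nonneg.2 hle) k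
    rw [← inner_sub_right]
    exact this
  have h4 : ⟪h, ((φ (star c * c) - star (φ c) * φ c : N) : H →L[ℂ] H) h⟫_ℂ
      = ⟪h, (φ (star c * c) : H →L[ℂ] H) h⟫_ℂ - ⟪k, k⟫_ℂ := by
    rw [hk, ← VonNeumannAlgebra.inner_star_mul, ← inner_sub_right]
    rfl
  rw [h4]
  convert add_nonneg h1 h3 using 1
  ring

end Schwarz

/-! ### Convergence of bounded nets of operators -/

theorem CStarAlgebra.mul_self_le_norm_smul {A : Type*} [NonUnitalCStarAlgebra A] [PartialOrder A]
    [StarOrderedRing A] {a : A} (ha : 0 ≤ a) : a * a ≤ ‖a‖ • a := by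
  have hs : star (CFC.sqrt a) = CFC.sqrt a :=
    (IsSelfAdjoint.of_nonneg (CFC.sqrt_nonneg a)).star_eq
  have hmul := CFC.sqrt_mul_sqrt_self a ha
  have h := CStarAlgebra.star_left_conjugate_le_norm_smul (a := CFC.sqrt a) (b := a)
    (IsSelfAdjoint.of_nonneg ha)
  rw [hs, hmul] at h
  calc a * a = CFC.sqrt a * CFC.sqrt a * (CFC.sqrt a * CFC.sqrt a) := by rw [hmul]
    _ = CFC.sqrt a * (CFC.sqrt a * CFC.sqrt a) * CFC.sqrt a := by simp only [mul_assoc]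
    _ = CFC.sqrt a * a * CFC.sqrt a := by rw [hmul]
    _ ≤ ‖a‖ • a := h

section Convergence

variable {H : Type*} [NormedAddCommGroup H] [InnerProductSpace ℂ H]

theorem TendstoSOT.unique {ι : Type*} {l : Filter ι} [l.NeBot] {f : ι → (H →L[ℂ] H)}
    {T T' : H →L[ℂ] H} (h : TendstoSOT f l T) (h' : TendstoSOT f l T') : T = T' :=
  ContinuousLinearMap.ext fun v => tendsto_nhds_unique (h v) (h' v)

theorem TendstoSOT.norm_le {ι : Type*} {l : Filter ι} [l.NeBot] {f : ι → (H →L[ℂ] H)}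
    {T : H →L[ℂ] H} (h : TendstoSOT f l T) {C : ℝ} (hC : ∀ i, ‖f i‖ ≤ C) : ‖T‖ ≤ C := by
  have hC0 : 0 ≤ C := by
    obtain ⟨i⟩ := l.nonempty_of_neBot
    exact (norm_nonneg _).trans (hC i)
  refine T.opNorm_le_bound hC0 fun v => ?_
  exact le_of_tendsto (h v).norm (.of_forall fun i => (f i).le_of_opNorm_le (hC i) v)

variable [CompleteSpace H] {N : VonNeumannAlgebra H}

theorem VonNeumannAlgebra.mem_of_tendstoSOT {ι : Type*} {l : Filter ι} [l.NeBot] {f : ι → N}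
    {T : H →L[ℂ] H} (h : TendstoSOT (fun i => (f i : H →L[ℂ] H)) l T) : T ∈ N := by
  rw [← N.commutant_commutant, VonNeumannAlgebra.mem_commutant_iff]
  intro g hg
  ext v
  have h₁ : Tendsto (fun i => g ((f i : H →L[ℂ] H) v)) l (𝓝 (g (T v))) :=
    (g.continuous.tendsto _).comp (h v)
  refine tendsto_nhds_unique h₁ ((h (g v)).congr fun i => ?_)
  exact congrArg (fun S : H →L[ℂ] H => S v)
    (VonNeumannAlgebra.mem_commutant_iff.1 hg (f i) (f i).2)

/-- Follows from a² ≤ ‖a‖a. It upgrades convergence of quadratic forms of positive operators to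
strong convergence. -/
theorem VonNeumannAlgebra.norm_apply_sq_le {a : N} (ha : 0 ≤ a) (h : H) :
    ‖(a : H →L[ℂ] H) h‖ ^ 2 ≤ ‖a‖ * (⟪h, (a : H →L[ℂ] H) h⟫_ℂ).re := by
  have h₁ := VonNeumannAlgebra.nonneg_iff_inner.1
    (sub_nonneg.2 (CStarAlgebra.mul_self_le_norm_smul ha)) h
  have h₂ : ⟪h, ((‖a‖ • a - a * a : N) : H →L[ℂ] H) h⟫_ℂ
      = (‖a‖ : ℂ) * ⟪h, (a : H →L[ℂ] H) h⟫_ℂ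
        - ⟪(a : H →L[ℂ] H) h, (a : H →L[ℂ] H) h⟫_ℂ := by
    rw [← VonNeumannAlgebra.inner_star_mul, (IsSelfAdjoint.of_nonneg ha).star_eq,
      ← inner_smul_right, ← inner_sub_right]
    rfl
  rw [h₂, inner_self_eq_norm_sq_to_K, Complex.nonneg_iff] at h₁
  have h₃ := h₁.1
  rw [Complex.sub_re, Complex.re_ofReal_mul] at h₃
  norm_cast at h₃
  change 0 ≤ _ - ‖(a : H →L[ℂ] H) h‖ ^ 2 at h₃
  linarith

/-- A bounded increasing net in a von Neumann algebra converges in the strong operator topology. -/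
theorem VonNeumannAlgebra.exists_tendstoSOT_of_monotone {ι : Type*} [Preorder ι]
    [IsDirectedOrder ι] [Nonempty ι] {f : ι → N} (hf : Monotone f) {C : ℝ}
    (hC : ∀ i, ‖f i‖ ≤ C) :
    ∃ z : N, TendstoSOT (fun i => (f i : H →L[ℂ] H)) atTop z ∧ ∀ i, f i ≤ z := by
  have hinner (v : H) {i j : ι} (hij : i ≤ j) :
      0 ≤ ⟪v, (f j : H →L[ℂ] H) v⟫_ℂ - ⟪v, (f i : H →L[ℂ] H) v⟫_ℂ := by
    rw [← inner_sub_right]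
    exact VonNeumannAlgebra.nonneg_iff_inner.1 (sub_nonneg.2 (hf hij)) v
  have hlim (v : H) : ∃ w, Tendsto (fun i => (f i : H →L[ℂ] H) v) atTop (𝓝 w) := by
    rw [← cauchy_map_iff_exists_tendsto]
    let g : ι → ℝ := fun i => (⟪v, (f i : H →L[ℂ] H) v⟫_ℂ).re
    have hg : Monotone g := fun i j hij =>
      sub_nonneg.1 ((Complex.nonneg_iff.1 (hinner v hij)).1.trans_eq (Complex.sub_re _ _))
    have hbdd : BddAbove (Set.range g) := by
      refine ⟨‖v‖ * (C * ‖v‖), ?_⟩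
      rintro _ ⟨i, rfl⟩
      refine (Complex.re_le_norm _).trans ((norm_inner_le_norm _ _).trans ?_)
      gcongr
      exact (f i : H →L[ℂ] H).le_of_opNorm_le (hC i) v
    have hgL := tendsto_atTop_ciSup hg hbdd
    set L := ⨆ i, g i
    refine Metric.cauchy_iff.2 ⟨inferInstance, fun ε hε => ?_⟩
    have hC0 : 0 ≤ C := (norm_nonneg _).trans (hC (Classical.arbitrary ι))
    -- The differences f i - f i₀ have norm at most 2C; the extra 1 keeps the divisor positive when
    -- C = 0.
    obtain ⟨i₀, hi₀⟩ := (hgL.eventually (lt_mem_nhds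
      (show L - (ε / 2) ^ 2 / (2 * C + 1) < L by simpa using by positivity))).exists
    refine ⟨_, image_mem_map (Ici_mem_atTop i₀), ?_⟩
    have key : ∀ i, i₀ ≤ i → dist ((f i : H →L[ℂ] H) v) ((f i₀ : H →L[ℂ] H) v) < ε / 2 := by
      intro i hi
      rw [dist_eq_norm]
      refine lt_of_pow_lt_pow_left₀ 2 (by positivity) ?_
      have h₁ := VonNeumannAlgebra.norm_apply_sq_le (sub_nonneg.2 (hf hi)) v
      have h₂ : ‖f i - f i₀‖ ≤ 2 * C + 1 := by
        linarith [norm_sub_le (f i) (f i₀), hC i, hC i₀]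
      have h₃ : (⟪v, ((f i - f i₀ : N) : H →L[ℂ] H) v⟫_ℂ).re = g i - g i₀ := by
        rw [← Complex.sub_re, ← inner_sub_right]
        rfl
      rw [h₃] at h₁
      have h₄ : g i - g i₀ < (ε / 2) ^ 2 / (2 * C + 1) := by
        linarith [le_ciSup hbdd i]
      calc ‖(f i : H →L[ℂ] H) v - (f i₀ : H →L[ℂ] H) v‖ ^ 2
          ≤ ‖f i - f i₀‖ * (g i - g i₀) := h₁
        _ ≤ (2 * C + 1) * (g i - g i₀) :=
            mul_le_mul_of_nonneg_right h₂ (sub_nonneg.2 (hg hi))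
        _ < (2 * C + 1) * ((ε / 2) ^ 2 / (2 * C + 1)) := by gcongr
        _ = (ε / 2) ^ 2 := by field_simp
    rintro _ ⟨i, hi, rfl⟩ _ ⟨j, hj, rfl⟩
    exact (dist_triangle_right _ _ _).trans_lt
      ((add_lt_add (key i hi) (key j hj)).trans_eq (add_halves ε))
  choose T hT using hlim
  let T' : H →L[ℂ] H := ContinuousLinearMap.ofTendstoOfBoundedRange T
    (fun i => (f i : H →L[ℂ] H)) (tendsto_pi_nhds.2 hT)
    (isBounded_iff_forall_norm_le.2 ⟨C, by rintro _ ⟨i, rfl⟩; exact hC i⟩)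
  have hT' : TendstoSOT (fun i => (f i : H →L[ℂ] H)) atTop T' := hT
  refine ⟨⟨T', VonNeumannAlgebra.mem_of_tendstoSOT hT'⟩, hT', fun i => ?_⟩
  rw [← sub_nonneg, VonNeumannAlgebra.nonneg_iff_inner]
  intro v
  have hv : Tendsto (fun j => ⟪v, (f j : H →L[ℂ] H) v⟫_ℂ - ⟪v, (f i : H →L[ℂ] H) v⟫_ℂ) atTop
      (𝓝 (⟪v, T' v⟫_ℂ - ⟪v, (f i : H →L[ℂ] H) v⟫_ℂ)) :=
    (tendsto_const_nhds.inner (hT' v)).sub_const _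
  have := ge_of_tendsto hv ((eventually_ge_atTop i).mono fun j hij => hinner v hij)
  rwa [← inner_sub_right] at this

/-- On bounded sets, strong convergence implies weak* convergence. -/
theorem TendstoSOT.tendsto_weakStar {ι : Type*} {l : Filter ι} {f : ι → N} {z : N}
    (h : TendstoSOT (fun i => (f i : H →L[ℂ] H)) l z) {C : ℝ} (hC : ∀ i, ‖f i‖ ≤ C) :
    Tendsto f l (@nhds N (weakStarTopology N) z) := by
  rw [nhds_iInf, tendsto_iInf]
  rintro ⟨⟨ξ, η⟩, hξ, hη⟩
  rw [nhds_induced, tendsto_comap_iff]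
  -- Dominated convergence for series holds along any filter, so nets are covered.
  refine tendsto_tsum_of_dominated_convergence (bound := fun n => C * (‖ξ n‖ ^ 2 + ‖η n‖ ^ 2))
    ((hξ.add hη).mul_left C) (fun n => tendsto_const_nhds.inner (h (η n))) ?_
  refine .of_forall fun i n => (norm_inner_le_norm _ _).trans ?_
  have hC0 : 0 ≤ C := (norm_nonneg _).trans (hC i)
  calc ‖ξ n‖ * ‖(f i : H →L[ℂ] H) (η n)‖ ≤ ‖ξ n‖ * (C * ‖η n‖) := by
        gcongr
        exact (f i : H →L[ℂ] H).le_of_opNorm_le (hC i) _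
    _ = C * (‖ξ n‖ * ‖η n‖) := by ring
    _ ≤ C * (‖ξ n‖ ^ 2 + ‖η n‖ ^ 2) := by
        gcongr
        nlinarith [sq_nonneg (‖ξ n‖ - ‖η n‖), sq_nonneg ‖ξ n‖, sq_nonneg ‖η n‖]

theorem continuous_weakStar_inner (ξ η : H) :
    Continuous[weakStarTopology N, _] fun x : N => ⟪ξ, (x : H →L[ℂ] H) η⟫_ℂ := by
  have hsum (v : H) : Summable fun n => ‖(Pi.single 0 v : ℕ → H) n‖ ^ 2 :=
    summable_of_ne_finset_zero (s := {0}) fun n hn => by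
      rw [Pi.single_eq_of_ne (by simpa using hn)]
      simp
  -- A vector functional is the normal functional given by sequences supported at index 0.
  refine continuous_iInf_dom (i := ⟨(Pi.single 0 ξ, Pi.single 0 η), hsum ξ, hsum η⟩) ?_
  convert continuous_induced_dom using 2 with x
  rw [tsum_eq_single 0]
  · simp
  · intro n hn
    simp [Pi.single_eq_of_ne hn]

end Convergence

/-! ### Semigroups of completely positive maps -/

section Inequalities

variable {A : Type*} [NonUnitalCStarAlgebra A]

/-- Reduces products of fixed points to the squares star u * u, the only products to which the
Schwarz inequality applies. -/
theorem mul_eq_polarization (x y : A) : x * y = (1 / 4 : ℂ) •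
    (star (star x + y) * (star x + y) - star (star x - y) * (star x - y)
      - Complex.I • (star (star x + Complex.I • y) * (star x + Complex.I • y)
        - star (star x - Complex.I • y) * (star x - Complex.I • y))) := by
  simp only [star_add, star_sub, star_smul, star_star, add_mul, mul_add, sub_mul, mul_sub,
    smul_mul_assoc, mul_smul_comm, RCLike.star_def, Complex.conj_I]
  match_scalars <;> ring_nf <;> simp [Complex.I_sq]
  norm_num

variable [PartialOrder A] [StarOrderedRing A]

theorem CStarAlgebra.star_add_mul_add_le (a b : A) :
    star (a + b) * (a + b) ≤ (2 : ℂ) • (star a * a + star b * b) := by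
  rw [← sub_nonneg]
  convert star_mul_self_nonneg (a - b) using 1
  simp only [star_add, star_sub, add_mul, mul_add, sub_mul, mul_sub]
  module

theorem CStarAlgebra.star_mul_mul_mul_le (a c : A) :
    star (a * c) * (a * c) ≤ (‖star a * a‖ : ℂ) • (star c * c) := by
  rw [star_mul, ← mul_assoc, mul_assoc (star c), Complex.coe_smul]
  exact CStarAlgebra.star_left_conjugate_le_norm_smul

theorem CStarAlgebra.star_mul_self_le_norm_smul {a : A} (ha : 0 ≤ a) :
    star a * a ≤ (‖a‖ : ℂ) • a := by
  rw [(IsSelfAdjoint.of_nonneg ha).star_eq, Complex.coe_smul]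
  exact CStarAlgebra.mul_self_le_norm_smul ha

end Inequalities

/-! ### Limits along the directed monoid. -/

section MonoidAtTop

variable {S : Type*} [AddCommMonoid S]

theorem monoidPreorder_isDirectedOrder :
    @IsDirectedOrder S (monoidPreorder S).toLE :=
  let := monoidPreorder S
  ⟨fun s t => ⟨s + t, ⟨t, rfl⟩, ⟨s, add_comm t s⟩⟩⟩

instance monoidAtTop_neBot : (monoidAtTop S).NeBot := by
  let := monoidPreorder S
  have := monoidPreorder_isDirectedOrder (S := S)
  exact inferInstanceAs (atTop : Filter S).NeBot

theorem tendsto_add_left_monoidAtTop (t : S) :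
    Tendsto (fun s => t + s) (monoidAtTop S) (monoidAtTop S) := by
  let := monoidPreorder S
  exact tendsto_atTop_mono (fun s => ⟨t, add_comm s t⟩) tendsto_id

end MonoidAtTop

section Semigroup

variable {H : Type*} [NormedAddCommGroup H] [InnerProductSpace ℂ H] [CompleteSpace H]
  {N : VonNeumannAlgebra H} {S : Type*}

/-- A semigroup of contractive, weak*-continuous, completely positive maps on a von Neumann
algebra. -/
structure IsCPSemigroup [AddCommMonoid S] (φ : S → (N →CP N)) : Prop where
  apply_zero : ∀ x : N, φ 0 x = x
  apply_add : ∀ (s t : S) (x : N), φ (s + t) x = φ s (φ t x)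
  contractive : ∀ (s : S) (x : N), ‖φ s x‖ ≤ ‖x‖
  weakStar : ∀ s : S, Continuous[weakStarTopology N, weakStarTopology N] (φ s)

/-- The common fixed points of a family of completely positive maps, as a subspace. -/
def fixedPointSubmodule (φ : S → (N →CP N)) : Submodule ℂ N where
  carrier := commonFixedPoints φ
  zero_mem' s := map_zero (φ s)
  add_mem' hx hy s := by rw [map_add, hx s, hy s]
  smul_mem' c x hx s := by rw [map_smul, hx s]

theorem star_mem_fixedPointSubmodule {φ : S → (N →CP N)} {x : N}
    (hx : x ∈ fixedPointSubmodule φ) : star x ∈ fixedPointSubmodule φ := fun s => by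
  rw [map_star, hx s]

variable [AddCommMonoid S] {φ : S → (N →CP N)}

/-- Elements of `N` on which the maps `φ s` tend to zero in the weak operator topology. -/
def asymptoticallyNull (φ : S → (N →CP N)) : Submodule ℂ N where
  carrier := {x | ∀ h : H, Tendsto (fun s => ⟪h, (φ s x : H →L[ℂ] H) h⟫_ℂ) (monoidAtTop S) (𝓝 0)}
  zero_mem' h := by simp
  add_mem' {x y} hx hy h := by
    simpa [map_add, inner_add_right] using (hx h).add (hy h)
  smul_mem' c x hx h := by
    have := (hx h).const_mul c
    rw [mul_zero] at this
    refine this.congr fun s => ?_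
    rw [map_smul, ← inner_smul_right]
    rfl

theorem asymptoticallyNull_of_le {x y : N} (hx : 0 ≤ x) (hxy : x ≤ y)
    (hy : y ∈ asymptoticallyNull φ) : x ∈ asymptoticallyNull φ := fun h => by
  refine squeeze_zero_norm (fun s => ?_) (tendsto_zero_iff_norm_tendsto_zero.1 (hy h))
  refine CStarAlgebra.norm_le_norm_of_nonneg_of_le
    (VonNeumannAlgebra.nonneg_iff_inner.1 (map_nonneg (φ s) hx) h) ?_
  have := VonNeumannAlgebra.nonneg_iff_inner.1
    (sub_nonneg.2 (OrderHomClass.mono (φ s) hxy)) h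
  rw [← sub_nonneg, ← inner_sub_right]
  exact this

/-- The left ideal of all `c` such that `φ s (star c * c)` tends to zero. -/
def asymptoticKernel (φ : S → (N →CP N)) : Submodule ℂ N where
  carrier := {c | star c * c ∈ asymptoticallyNull φ}
  zero_mem' := by
    rw [Set.mem_ofPred_eq, mul_zero]
    exact zero_mem _
  add_mem' {a b} ha hb := by
    rw [Set.mem_ofPred_eq] at ha hb ⊢
    have h2 : (2 : ℂ) • (star a * a + star b * b) ∈ asymptoticallyNull φ :=
      Submodule.smul_mem _ _ (Submodule.add_mem _ ha hb)
    have hle := CStarAlgebra.star_add_mul_add_le a b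
    have h0 := star_mul_self_nonneg (a + b)
    exact asymptoticallyNull_of_le h0 hle h2
  smul_mem' r c hc := by
    rw [Set.mem_ofPred_eq] at hc ⊢
    rw [star_smul, smul_mul_smul_comm]
    exact Submodule.smul_mem _ _ hc

theorem mul_mem_asymptoticKernel (a : N) {c : N} (hc : c ∈ asymptoticKernel φ) :
    a * c ∈ asymptoticKernel φ := by
  change star (a * c) * (a * c) ∈ asymptoticallyNull φ
  have hle := CStarAlgebra.star_mul_mul_mul_le a c
  have h0 := star_mul_self_nonneg (a * c)
  have hmem : (‖star a * a‖ : ℂ) • (star c * c) ∈ asymptoticallyNull φ :=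
    Submodule.smul_mem _ _ hc
  exact asymptoticallyNull_of_le h0 hle hmem

theorem mem_asymptoticKernel_of_nonneg {q : N} (hq : 0 ≤ q) (h : q ∈ asymptoticallyNull φ) :
    q ∈ asymptoticKernel φ := by
  change star q * q ∈ asymptoticallyNull φ
  have hle := CStarAlgebra.star_mul_self_le_norm_smul hq
  have h0 := star_mul_self_nonneg q
  have hmem : (‖q‖ : ℂ) • q ∈ asymptoticallyNull φ := Submodule.smul_mem _ _ h
  exact asymptoticallyNull_of_le h0 hle hmem

/-! ### Convergence of orbits. -/

namespace IsCPSemigroup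

theorem tendstoSOT_zero (hφ : IsCPSemigroup φ) {c : N} (hc : c ∈ asymptoticKernel φ) :
    TendstoSOT (fun s => (φ s c : H →L[ℂ] H)) (monoidAtTop S) 0 := fun h => by
  have hsq : Tendsto (fun s => ‖(φ s c : H →L[ℂ] H) h‖ ^ 2) (monoidAtTop S) (𝓝 0) := by
    refine squeeze_zero (fun s => by positivity) (fun s => ?_)
      (tendsto_zero_iff_norm_tendsto_zero.1 (hc h))
    have h₁ := VonNeumannAlgebra.nonneg_iff_inner.1
      (sub_nonneg.2 ((φ s).schwarz (hφ.contractive s) c)) h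
    have h₂ : ⟪(φ s c : H →L[ℂ] H) h, (φ s c : H →L[ℂ] H) h⟫_ℂ
        ≤ ⟪h, (φ s (star c * c) : H →L[ℂ] H) h⟫_ℂ := by
      rw [← VonNeumannAlgebra.inner_star_mul, ← sub_nonneg, ← inner_sub_right]
      exact h₁
    refine le_trans (le_of_eq ?_) (CStarAlgebra.norm_le_norm_of_nonneg_of_le ?_ h₂)
    · rw [inner_self_eq_norm_sq_to_K]
      simp
    · rw [inner_self_eq_norm_sq_to_K]
      positivity
  have := hsq.sqrt
  simp only [Real.sqrt_sq (norm_nonneg _), Real.sqrt_zero] at this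
  exact tendsto_zero_iff_norm_tendsto_zero.2 this

/-- Strong limits of orbits of the semigroup are fixed points. -/
theorem mem_fixedPointSubmodule_of_tendstoSOT (hφ : IsCPSemigroup φ) {x z : N}
    (h : TendstoSOT (fun s => (φ s x : H →L[ℂ] H)) (monoidAtTop S) z) :
    z ∈ fixedPointSubmodule φ := fun t => by
  -- The net φ_t(φ_s x) tends weak* to φ_t(z), yet it is the shifted orbit φ_{t+s}(x), which tends
  -- to z.
  have hweak := (@Continuous.tendsto _ _ (weakStarTopology N) (weakStarTopology N) _
    (hφ.weakStar t) z).comp (h.tendsto_weakStar fun s => hφ.contractive s x)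
  refine Subtype.ext <| ContinuousLinearMap.ext fun v => ext_inner_left ℂ fun w => ?_
  have h₁ := (@Continuous.tendsto _ _ (weakStarTopology N) _ _
    (continuous_weakStar_inner (N := N) w v) (φ t z)).comp hweak
  have h₂ : Tendsto (fun s => ⟪w, (φ (t + s) x : H →L[ℂ] H) v⟫_ℂ) (monoidAtTop S)
      (𝓝 ⟪w, (z : H →L[ℂ] H) v⟫_ℂ) :=
    tendsto_const_nhds.inner ((h v).comp (tendsto_add_left_monoidAtTop t))
  refine tendsto_nhds_unique h₁ (h₂.congr fun s => ?_)
  rw [hφ.apply_add]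
  rfl

theorem star_mul_self_mem_sup (hφ : IsCPSemigroup φ) {x : N} (hx : x ∈ fixedPointSubmodule φ) :
    star x * x ∈ fixedPointSubmodule φ ⊔ asymptoticKernel φ := by
  have hle (r : S) : star x * x ≤ φ r (star x * x) := by
    simpa only [hx r] using (φ r).schwarz (hφ.contractive r) x
  let := monoidPreorder S
  have := monoidPreorder_isDirectedOrder (S := S)
  have hmono : Monotone fun s => φ s (star x * x) := by
    rintro s _ ⟨r, rfl⟩
    dsimp only
    rw [hφ.apply_add]
    exact OrderHomClass.mono (φ s) (hle r)
  obtain ⟨z, hz, hzle⟩ := VonNeumannAlgebra.exists_tendstoSOT_of_monotone hmono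
    fun s => hφ.contractive s _
  have hzfix := hφ.mem_fixedPointSubmodule_of_tendstoSOT hz
  have hnull : z - star x * x ∈ asymptoticallyNull φ := fun h => by
    have hlim : Tendsto (fun s => ⟪h, (z : H →L[ℂ] H) h - (φ s (star x * x) : H →L[ℂ] H) h⟫_ℂ)
        (monoidAtTop S) (𝓝 ⟪h, (z : H →L[ℂ] H) h - (z : H →L[ℂ] H) h⟫_ℂ) :=
      tendsto_const_nhds.inner ((hz h).const_sub _)
    rw [sub_self, inner_zero_right] at hlim
    refine hlim.congr fun s => ?_
    rw [map_sub, hzfix s]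
    rfl
  -- Positivity of the defect, x*x ≤ φ_0(x*x) ≤ z, is what turns weak nullity into membership in the
  -- kernel.
  have hker := mem_asymptoticKernel_of_nonneg (sub_nonneg.2 ((hle 0).trans (hzle 0))) hnull
  refine Submodule.mem_sup.2 ⟨z, hzfix, -(z - star x * x), neg_mem hker, by abel⟩

theorem mul_mem_sup (hφ : IsCPSemigroup φ) {x y : N} (hx : x ∈ fixedPointSubmodule φ)
    (hy : y ∈ fixedPointSubmodule φ) :
    x * y ∈ fixedPointSubmodule φ ⊔ asymptoticKernel φ := by
  set F := fixedPointSubmodule φ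
  have hx' : star x ∈ F := star_mem_fixedPointSubmodule hx
  have hI : Complex.I • y ∈ F := F.smul_mem _ hy
  rw [mul_eq_polarization]
  exact Submodule.smul_mem _ _ <| sub_mem
    (sub_mem (hφ.star_mul_self_mem_sup (add_mem hx' hy))
      (hφ.star_mul_self_mem_sup (sub_mem hx' hy)))
    (Submodule.smul_mem _ _ (sub_mem (hφ.star_mul_self_mem_sup (add_mem hx' hI))
      (hφ.star_mul_self_mem_sup (sub_mem hx' hI))))

theorem mem_sup_of_mem_adjoin (hφ : IsCPSemigroup φ) {a : N}
    (ha : a ∈ NonUnitalStarAlgebra.adjoin ℂ (commonFixedPoints φ)) :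
    a ∈ fixedPointSubmodule φ ⊔ asymptoticKernel φ := by
  set W := fixedPointSubmodule φ ⊔ asymptoticKernel φ with hW
  -- W = F + K is not known to be closed under products, since K is only a left ideal. The induction
  -- therefore carries the stronger claim that a multiplies W into itself from the left.
  suffices a ∈ W ∧ ∀ w ∈ W, a * w ∈ W from this.1
  change a ∈ NonUnitalAlgebra.adjoin ℂ (commonFixedPoints φ ∪ star (commonFixedPoints φ)) at ha
  induction ha using NonUnitalAlgebra.adjoin_induction with
  | mem x hx =>
    have hxF : x ∈ fixedPointSubmodule φ := by
      rcases hx with hx | hx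
      · exact hx
      · simpa using star_mem_fixedPointSubmodule (φ := φ) (x := star x) hx
    refine ⟨Submodule.mem_sup_left hxF, fun w hw => ?_⟩
    obtain ⟨z, hz, c, hc, rfl⟩ := Submodule.mem_sup.1 hw
    rw [mul_add]
    exact add_mem (hφ.mul_mem_sup hxF hz)
      (Submodule.mem_sup_right (mul_mem_asymptoticKernel x hc))
  | add x y _ _ hx hy =>
    exact ⟨add_mem hx.1 hy.1, fun w hw => by rw [add_mul]; exact add_mem (hx.2 w hw) (hy.2 w hw)⟩
  | zero => exact ⟨zero_mem _, fun w _ => by rw [zero_mul]; exact zero_mem _⟩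
  | mul x y _ _ hx hy =>
    exact ⟨hx.2 y hy.1, fun w hw => by rw [mul_assoc]; exact hx.2 _ (hy.2 w hw)⟩
  | smul r x _ hx =>
    exact ⟨W.smul_mem r hx.1, fun w hw => by rw [smul_mul_assoc]; exact W.smul_mem r (hx.2 w hw)⟩

/-- The elements whose orbit converges strongly form a norm-closed set. -/
theorem isClosed_setOf_tendstoSOT (hφ : IsCPSemigroup φ) :
    IsClosed {y : N | ∃ z : N, TendstoSOT (fun s => (φ s y : H →L[ℂ] H)) (monoidAtTop S) z} := by
  refine isClosed_of_closure_subset fun y hy => ?_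
  obtain ⟨u, hu, hlim⟩ := mem_closure_iff_seq_limit.1 hy
  choose z hz using hu
  -- The limit is contractive where it exists, so limits of orbits of a Cauchy sequence are Cauchy;
  -- an ε/3 argument then identifies the limit.
  have hdist (m n : ℕ) : dist (z m) (z n) ≤ dist (u m) (u n) := by
    rw [dist_eq_norm, dist_eq_norm]
    refine TendstoSOT.norm_le (l := monoidAtTop S)
      (f := fun s => ((φ s (u m - u n) : N) : H →L[ℂ] H)) (fun h => ?_)
      fun s => hφ.contractive s _
    refine ((hz m h).sub (hz n h)).congr fun s => ?_
    dsimp only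
    rw [map_sub]
    rfl
  have hcauchy : CauchySeq z := by
    refine Metric.cauchySeq_iff.2 fun ε hε => ?_
    obtain ⟨k, hk⟩ := Metric.cauchySeq_iff.1 hlim.cauchySeq ε hε
    exact ⟨k, fun m hm n hn => (hdist m n).trans_lt (hk m hm n hn)⟩
  obtain ⟨w, hw⟩ := cauchySeq_tendsto_of_complete hcauchy
  refine ⟨w, fun h => Metric.tendsto_nhds.2 fun ε hε => ?_⟩
  have hδ : 0 < ε / 3 / (‖h‖ + 1) := by positivity
  obtain ⟨n, hn₁, hn₂⟩ := ((Metric.tendsto_nhds.1 hlim _ hδ).and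
    (Metric.tendsto_nhds.1 hw _ hδ)).exists
  have hsmall {a b : N} (hab : dist a b < ε / 3 / (‖h‖ + 1)) :
      dist ((a : H →L[ℂ] H) h) ((b : H →L[ℂ] H) h) < ε / 3 := by
    rw [dist_eq_norm] at hab ⊢
    calc ‖(a : H →L[ℂ] H) h - (b : H →L[ℂ] H) h‖ ≤ ‖a - b‖ * ‖h‖ :=
          ((a - b : N) : H →L[ℂ] H).le_opNorm h
      _ ≤ ‖a - b‖ * (‖h‖ + 1) := by gcongr; linarith
      _ < ε / 3 / (‖h‖ + 1) * (‖h‖ + 1) := by gcongr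
      _ = ε / 3 := by field_simp
  filter_upwards [Metric.tendsto_nhds.1 (hz n h) (ε / 3) (by positivity)] with s hs
  have h₁ : dist (φ s y) (φ s (u n)) < ε / 3 / (‖h‖ + 1) := by
    rw [dist_comm, dist_eq_norm, ← map_sub]
    exact (hφ.contractive s _).trans_lt (by rwa [← dist_eq_norm])
  calc dist ((φ s y : H →L[ℂ] H) h) ((w : H →L[ℂ] H) h)
      ≤ _ := dist_triangle4 _ ((φ s (u n) : H →L[ℂ] H) h) ((z n : H →L[ℂ] H) h) _
    _ < ε / 3 + ε / 3 + ε / 3 := add_lt_add (add_lt_add (hsmall h₁) hs) (hsmall hn₂)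
    _ = ε := by ring

theorem exists_tendstoSOT (hφ : IsCPSemigroup φ) (y : generatedCStar (commonFixedPoints φ)) :
    ∃ z : N, TendstoSOT (fun s => (φ s (y : N) : H →L[ℂ] H)) (monoidAtTop S) z := by
  refine closure_minimal (fun a ha => ?_) hφ.isClosed_setOf_tendstoSOT y.2
  obtain ⟨z, hz, c, hc, rfl⟩ := Submodule.mem_sup.1 (hφ.mem_sup_of_mem_adjoin ha)
  refine ⟨z, fun h => ?_⟩
  have := (hφ.tendstoSOT_zero hc h).const_add ((z : H →L[ℂ] H) h)
  rw [zero_apply, add_zero] at this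
  refine this.congr fun s => ?_
  dsimp only
  rw [map_add, hz s]
  rfl

end IsCPSemigroup

theorem mem_generatedCStar_of_mem {A : Type*} [NonUnitalCStarAlgebra A] {X : Set A} {x : A}
    (hx : x ∈ X) : x ∈ generatedCStar X :=
  NonUnitalStarSubalgebra.le_topologicalClosure _
    (NonUnitalStarAlgebra.subset_adjoin ℂ X hx)

/-- A linear map on a C*-subalgebra of `N` that is a pointwise strong limit of completely positive
maps on `N` is completely positive. -/
theorem map_nonneg_of_tendstoSOT {ι : Type*} {l : Filter ι} [l.NeBot] {ψ : ι → (N →CP N)}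
    {X : Set N} (f : generatedCStar X →ₗ[ℂ] generatedCStar X)
    (hf : ∀ y : generatedCStar X,
      TendstoSOT (fun i => ((ψ i (y : N) : N) : H →L[ℂ] H)) l ((f y : N) : H →L[ℂ] H))
    {n : Type*} [Fintype n] (M : CStarMatrix n n (generatedCStar X)) (hM : 0 ≤ M) :
    0 ≤ M.map f := by
  let π : N →⋆ₙₐ[ℂ] (H →L[ℂ] H) := NonUnitalStarSubalgebraClass.subtype N
  let j : generatedCStar X →⋆ₙₐ[ℂ] N := NonUnitalStarSubalgebraClass.subtype _
  have hπ : Function.Injective π := Subtype.val_injective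
  have hj : Function.Injective j := Subtype.val_injective
  have hjM : 0 ≤ CStarMatrix.mapₙₐ j M := map_nonneg (CStarMatrix.mapₙₐ j) hM
  -- In the faithful representation on Hⁿ positivity is a family of scalar inequalities, each
  -- preserved by strong limits of the entries.
  rw [CStarMatrix.nonneg_iff_inner (π.comp j) (hπ.comp hj)]
  intro ξ
  refine ge_of_tendsto' (tendsto_finsetSum _ fun i _ => tendsto_finsetSum _ fun k _ =>
    tendsto_const_nhds.inner (hf (M i k) (ξ k))) fun s => ?_
  exact (CStarMatrix.nonneg_iff_inner π hπ _).1 ((ψ s).map_cstarMatrix_nonneg _ hjM) ξ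

end Semigroup

end FixedPointLimits

theorem theorem2 {H : Type*} [NormedAddCommGroup H] [InnerProductSpace ℂ H] [CompleteSpace H]
    (N : VonNeumannAlgebra H) {S : Type*} [AddCommMonoid S] (φ : S → (N →CP N))
    (hφ_zero : ∀ x : N, φ 0 x = x)
    (hφ_add : ∀ (s t : S) (x : N), φ (s + t) x = φ s (φ t x))
    (hφ_contractive : ∀ (s : S) (x : N), ‖φ s x‖ ≤ ‖x‖)
    (hφ_weakStar : ∀ s : S, Continuous[weakStarTopology N, weakStarTopology N] (φ s)) :
    ∃ Φ : generatedCStar (commonFixedPoints φ) →CP generatedCStar (commonFixedPoints φ),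
      (∀ y : generatedCStar (commonFixedPoints φ),
        TendstoSOT (fun s => ((φ s (y : N) : N) : H →L[ℂ] H)) (monoidAtTop S)
          ((Φ y : N) : H →L[ℂ] H)) ∧
      (∀ y, ‖Φ y‖ ≤ ‖y‖) ∧
      (∀ y, Φ (Φ y) = Φ y) ∧
      Set.range (fun y => (Φ y : N)) = commonFixedPoints φ := by
  have hφ : IsCPSemigroup φ := ⟨hφ_zero, hφ_add, hφ_contractive, hφ_weakStar⟩
  choose P hP using hφ.exists_tendstoSOT
  have hfix (y) : P y ∈ commonFixedPoints φ := hφ.mem_fixedPointSubmodule_of_tendstoSOT (hP y)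
  -- Uniqueness of strong limits yields linearity, and also P y = y on fixed points, whose orbits
  -- are constant; idempotence and the range follow.
  have huniq {y : generatedCStar (commonFixedPoints φ)} {z : N}
      (hz : TendstoSOT (fun s => ((φ s (y : N) : N) : H →L[ℂ] H)) (monoidAtTop S) z) :
      P y = z := Subtype.ext ((hP y).unique hz)
  have hPfix {y : generatedCStar (commonFixedPoints φ)}
      (hy : (y : N) ∈ commonFixedPoints φ) : P y = y :=
    huniq fun h => tendsto_const_nhds.congr fun s => by dsimp only; rw [hy s]
  let f : generatedCStar (commonFixedPoints φ) →ₗ[ℂ] generatedCStar (commonFixedPoints φ) :=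
    { toFun := fun y => ⟨P y, mem_generatedCStar_of_mem (hfix y)⟩
      map_add' := fun x y => Subtype.ext <| huniq fun h =>
        ((hP x h).add (hP y h)).congr fun s => by
          change _ = ((φ s ((x : N) + y) : N) : H →L[ℂ] H) h
          rw [map_add]
          rfl
      map_smul' := fun c x => Subtype.ext <| huniq fun h =>
        ((hP x h).const_smul c).congr fun s => by
          change _ = ((φ s (c • (x : N)) : N) : H →L[ℂ] H) h
          rw [map_smul]
          rfl }
  refine ⟨⟨f, fun k M hM => map_nonneg_of_tendstoSOT f hP M hM⟩, hP, fun y => ?_, fun y => ?_, ?_⟩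
  · exact (hP y).norm_le fun s => hφ.contractive s y
  · exact Subtype.ext (hPfix (hfix y))
  · refine Set.Subset.antisymm ?_ fun x hx => ⟨⟨x, mem_generatedCStar_of_mem hx⟩, hPfix hx⟩
    rintro _ ⟨y, rfl⟩
    exact hfix y
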